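/- Work in $\mathbb F_2[x]$. For a nonzero $A\in\mathbb F_2[x]$ let $\sigma(A)$ be the sum of all divisors of $A$ in $\mathbb F_2[x]$; $A$ is perfect if $\sigma(A)=A$. A polynomial is odd if it has no factor of degree $1$. A Mersenne prime polynomial is an irreducible polynomial of the form $1+x^a(x+1)^b$ with integers $a,b\ge 1$. A special polynomial is one of the form $S=P_1^2\cdots P_m^2$ with $m\ge 1$ and $P_1,\dots,P_m$ pairwise distinct, odd and irreducible. (i) There is no special polynomial that is perfect and all of whose irreducible factors are Mersenne prime polynomials. (ii) Let $A=P_1^{2h_1}\cdots P_m^{2h_m}$, where $P_1,\dots,P_m$ are pairwise distinct Mersenne prime polynomials and $h_1,\dots,h_m$ are nonnegative integers. If for some $j$ the integer $2h_j+1$ is divisible by a Mersenne prime number $p=2^n-1\neq 7$ or by a Fermat prime number $p=2^{2^n}+1\neq 5$ (with $p$ prime and $n\geq 0$ an integer), then $A$ is not perfect. -/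

import Mathlib

open Polynomial

namespace F2Poly

/-- The divisors of a nonzero polynomial over `𝔽₂` form a finite set, so that the sum of all
divisors is an honest finite sum. -/
theorem finite_divisors {A : (ZMod 2)[X]} (hA : A ≠ 0) : {d : (ZMod 2)[X] | d ∣ A}.Finite := by
  refine Set.Finite.of_injOn (f := fun d => fun i : Fin (A.natDegree + 1) => d.coeff i)
    (t := Set.univ) (fun _ _ => Set.mem_univ _) ?_ Set.finite_univ
  intro d hd e he h
  ext n
  by_cases hn : n < A.natDegree + 1
  · exact congrFun h ⟨n, hn⟩
  · have h1 := natDegree_le_of_dvd hd hA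
    have h2 := natDegree_le_of_dvd he hA
    rw [coeff_eq_zero_of_natDegree_lt (by omega), coeff_eq_zero_of_natDegree_lt (by omega)]

/-- `σ(A)`: the sum of all divisors of the nonzero polynomial `A` over `𝔽₂`. (The only unit of
`𝔽₂[x]` is `1`, so no normalization of the divisors is needed.) -/
noncomputable def sigma (A : (ZMod 2)[X]) : (ZMod 2)[X] :=
  ∑ᶠ d ∈ {d : (ZMod 2)[X] | d ∣ A}, d

/-- A nonzero polynomial `A` over `𝔽₂` is perfect if `σ(A) = A`. -/
def IsPerfect (A : (ZMod 2)[X]) : Prop :=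
  A ≠ 0 ∧ sigma A = A

/-- A polynomial over `𝔽₂` is even if it has a linear factor. -/
def IsEven (A : (ZMod 2)[X]) : Prop :=
  ∃ L : (ZMod 2)[X], L.degree = 1 ∧ L ∣ A

/-- A polynomial over `𝔽₂` is odd if it has no linear factor. -/
def IsOdd (A : (ZMod 2)[X]) : Prop :=
  ¬ IsEven A

/-- A Mersenne prime polynomial: irreducible of the form `1 + x^a (x+1)^b` with `a, b ≥ 1`. -/
def IsMersennePrime (P : (ZMod 2)[X]) : Prop :=
  Irreducible P ∧ ∃ a b : ℕ, 0 < a ∧ 0 < b ∧ P = 1 + X ^ a * (X + 1) ^ b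

/-- Special polynomials: `S = P₁² ⋯ P_m²` with `m ≥ 1` and with pairwise distinct odd irreducible
polynomials `P₁, …, P_m`. -/
def IsSpecial (S : (ZMod 2)[X]) : Prop :=
  ∃ (m : ℕ) (P : Fin m → (ZMod 2)[X]), 1 ≤ m ∧ Function.Injective P ∧
    (∀ j, Irreducible (P j) ∧ IsOdd (P j)) ∧ S = ∏ j, P j ^ 2

/-- A (rational integer) Mersenne prime: a prime number of the form `2^n - 1`. -/
def IsMersennePrimeNumber (p : ℕ) : Prop :=
  p.Prime ∧ ∃ n : ℕ, p = mersenne n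

/-- A (rational integer) Fermat prime: a prime number of the form `2^(2^n) + 1`. -/
def IsFermatPrimeNumber (p : ℕ) : Prop :=
  p.Prime ∧ ∃ n : ℕ, p = Nat.fermatNumber n

end F2Poly

/-!
Let `A = ∏ P_i ^ (2 h_i)` be perfect, all `P_i` being Mersenne prime polynomials, and let the prime `p`
divide `2 h_j + 1`; put `P = P_j = 1 + U` with `U = x ^ a (x + 1) ^ b`. Then
`Φ_p(P) = 1 + P + ⋯ + P ^ (p - 1)` divides `σ(P ^ (2 h_j))`, hence `σ(A) = A`, so that all its
irreducible factors are among the `P_i` with `h_i > 0`. Part (i) is the case `h_i = 1`, `p = 3` of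
part (ii).

* If `p = 2 ^ n - 1`, every `α ∈ 𝔽_{2^n}` other than `0, 1` is a root of `P` or of `Φ_p(P)`, because
  `U(α) ≠ 0` and `P(α) ^ p = 1` when `P(α) ≠ 0` (`minpoly_dvd_or_dvd_geom_sum`). Thus every
  irreducible polynomial of degree `n` is one of the `P_i`, so is Mersenne. As there are at most
  `n - 1` Mersenne polynomials of degree `n`, this gives `2 ^ n - 2 ≤ n (n - 1)`, which fails for
  `n ≥ 5` (`exists_not_isMersennePrime_minpoly`).
* If `p = 3`, the same argument shows that `x ^ 2 + x + 1` is one of the `P_i` with `h_i > 0`. It is the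
  only Mersenne prime of degree `2`, and all the others have larger degree, so `σ(A)` and `A`
  differ in the coefficient of degree `deg A - 2` (`prod_sum_pow_ne_of_unique_min_degree`).
* If `p = 2 ^ 2 ^ n + 1 ≥ 17`, an irreducible factor of `Φ_p(P)` of degree `r` gives an element of
  order `p` in `𝔽_{2^r}`, so the order `2 ^ (n + 1)` of `2` modulo `p` divides `r` and `8 ∣ r`.
  But no Mersenne prime polynomial has degree divisible by `8` (`not_eight_dvd_of_irreducible`).

The last fact is a case of the theorems of Stickelberger and Swan. Lift `1 + x ^ c (x + 1) ^ d` to `ℤ[x]`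
and consider its roots `θ_i` in the ring of integers of a splitting field. If the reduction modulo
`2` is irreducible, a Frobenius element permutes the roots in one cycle, of even length `c + d`,
and so changes the sign of `δ = ∏_{i<j} (θ_i - θ_j)`. On the other hand `δ ^ 2`, the discriminant,
is `≡ 1` modulo `8`, whence `γ = (δ - 1) / 2` is an algebraic integer with `γ ^ 2 + γ ≡ 0` modulo `2`.
The Frobenius element maps it to `-1 - γ`, although it should be congruent to `γ ^ 2`.
-/

open Polynomial

namespace F2Poly

/-! ### Frobenius and the square root of the discriminant -/

/-- A monic polynomial of degree `r` with `r` distinct roots `θ` is `∏ (X - θ i)`. -/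
theorem eq_prod_X_sub_C_of_injective {S : Type*} [CommRing S] [IsDomain S] {r : ℕ} {f : S[X]}
    (hf : f.Monic) (hr : f.natDegree = r) (θ : Fin r → S) (hinj : Function.Injective θ)
    (hroot : ∀ i, f.IsRoot (θ i)) : f = ∏ i, (X - C (θ i)) := by
  classical
  have hle : (Finset.univ.val.map θ) ≤ f.roots := by
    rw [Multiset.le_iff_subset (Finset.univ.nodup.map hinj)]
    intro a ha
    obtain ⟨i, -, rfl⟩ := Multiset.mem_map.1 ha
    exact (mem_roots hf.ne_zero).2 (hroot i)
  have hdvd : ∏ i, (X - C (θ i)) ∣ f := by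
    have := (Multiset.prod_X_sub_C_dvd_iff_le_roots hf.ne_zero _).2 hle
    rwa [Multiset.map_map] at this
  have hmon : (∏ i, (X - C (θ i))).Monic := monic_prod_of_monic _ _ fun i _ => monic_X_sub_C _
  refine eq_of_monic_of_dvd_of_natDegree_le hmon hf hdvd ?_
  rw [hr, natDegree_prod_of_monic _ _ fun i _ => monic_X_sub_C _]
  simp

/-- The iterates `α, α², α⁴, …, α^(2^(r-1))` of Frobenius on a root of an irreducible polynomial of
degree `r` over `𝔽₂` are pairwise distinct. -/
theorem eq_of_pow_two_pow_eq {k : Type*} [Field k] [Algebra (ZMod 2) k] {f : (ZMod 2)[X]}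
    (hf : Irreducible f) {α : k} (hα : aeval α f = 0) {i j : ℕ} (hij : i ≤ j)
    (hj : j < f.natDegree + i) (h : α ^ 2 ^ i = α ^ 2 ^ j) : i = j := by
  have : CharP k 2 := charP_of_injective_algebraMap (algebraMap (ZMod 2) k).injective 2
  obtain ⟨m, rfl⟩ := Nat.exists_eq_add_of_le hij
  have hm : α ^ 2 ^ m = α := by
    apply (iterateFrobenius k 2 i).injective
    rw [iterateFrobenius_def, iterateFrobenius_def, ← pow_mul, ← pow_add, add_comm m i, h]
  have hdvd : f ∣ X ^ (Nat.card (ZMod 2)) ^ m - X := by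
    refine dvd_trans (Irreducible.dvd_symm (minpoly.irreducible ?_) hf (minpoly.dvd _ _ hα))
      (minpoly.dvd _ α ?_)
    · exact IsAlgebraic.isIntegral ⟨f, hf.ne_zero, hα⟩
    · simp [hm]
  have := hf.natDegree_dvd_of_dvd_X_pow_card_pow_sub_X hdvd
  have hm0 : m = 0 := Nat.eq_zero_of_dvd_of_lt this (by omega)
  simp [hm0]

theorem sign_finRotate_of_even {r : ℕ} (hr : Even r) (hr0 : 0 < r) :
    Equiv.Perm.sign (finRotate r) = -1 := by
  rw [sign_finRotate]
  exact Odd.neg_one_pow (by obtain ⟨k, rfl⟩ := hr; exact ⟨k - 1, by omega⟩)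

/-- A Frobenius lift permutes the roots of an irreducible polynomial cyclically, so that it changes
the sign of the square root `∏_{i<j} (θ i - θ j)` of the discriminant when the degree is even. -/
theorem exists_roots_frobenius_neg {S : Type*} [CommRing S] [IsDomain S] {𝔪 : Ideal S}
    [𝔪.IsMaximal] (h2 : (2 : S) ∈ 𝔪) (φ : S →+* S) (hφ : ∀ x, φ x - x ^ 2 ∈ 𝔪)
    {F : ℤ[X]} (hF : F.Monic) (hirr : Irreducible (F.map (Int.castRingHom (ZMod 2))))
    {r : ℕ} (hr : F.natDegree = r) (hreven : Even r) {θ₀ : S} (hθ₀ : aeval θ₀ F = 0) :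
    ∃ θ : Fin r → S, F.map (algebraMap ℤ S) = ∏ i, (X - C (θ i)) ∧
      φ (∏ i, ∏ j ∈ Finset.Ioi i, (θ i - θ j)) = -∏ i, ∏ j ∈ Finset.Ioi i, (θ i - θ j) := by
  let k := S ⧸ 𝔪
  let _ : Field k := Ideal.Quotient.field 𝔪
  let q : S →+* k := Ideal.Quotient.mk 𝔪
  have hk2 : ((2 : ℕ) : k) = 0 := by
    have : q 2 = 0 := Ideal.Quotient.eq_zero_iff_mem.2 h2
    rw [Nat.cast_ofNat, ← map_ofNat q 2, this]
  have : CharP k 2 := CharTwo.of_one_ne_zero_of_two_eq_zero one_ne_zero (by simpa using hk2)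
  let _ : Algebra (ZMod 2) k := ZMod.algebra k 2
  have hq (x : S) : q (φ x) = q x ^ 2 := by
    rw [← map_pow]; exact Ideal.Quotient.eq.2 (hφ x)
  have hqi (i : ℕ) (x : S) : q (φ^[i] x) = q x ^ 2 ^ i := by
    induction i with
    | zero => simp
    | succ i ih => rw [Function.iterate_succ_apply', hq, ih, ← pow_mul, pow_succ]
  have hroot (x : S) (hx : aeval x F = 0) : aeval (φ x) F = 0 := by
    have := congrArg φ hx
    rw [aeval_def, hom_eval₂, map_zero] at this
    rwa [aeval_def, show algebraMap ℤ S = φ.comp (algebraMap ℤ S) from RingHom.ext_int _ _]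
  have hrooti (i : ℕ) : aeval (φ^[i] θ₀) F = 0 := by
    induction i with
    | zero => simpa
    | succ i ih => rw [Function.iterate_succ_apply']; exact hroot _ ih
  set f := F.map (Int.castRingHom (ZMod 2)) with hfdef
  have hfr : f.natDegree = r := by rw [hF.natDegree_map, hr]
  have hα : aeval (q θ₀) f = 0 := by
    rw [hfdef, aeval_def, eval₂_map]
    have := congrArg q hθ₀
    rw [aeval_def, hom_eval₂, map_zero] at this
    rwa [show ((algebraMap (ZMod 2) k).comp (Int.castRingHom (ZMod 2))) =
      q.comp (algebraMap ℤ S) from RingHom.ext_int _ _]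
  have hr0 : 0 < r := hfr ▸ hirr.natDegree_pos
  let θ : Fin r → S := fun i => φ^[i] θ₀
  have hinjq : Function.Injective fun i => q (θ i) := by
    have key : ∀ i j : Fin r, i ≤ j → q (θ i) = q (θ j) → i = j := by
      intro i j hij h
      simp only [θ, hqi] at h
      exact Fin.ext (eq_of_pow_two_pow_eq hirr hα hij (by omega) h)
    intro i j h
    rcases le_total i j with hij | hij
    · exact key i j hij h
    · exact (key j i hij h.symm).symm
  have hinj : Function.Injective θ := fun i j h => hinjq (congrArg q h)
  have hFmon : (F.map (algebraMap ℤ S)).Monic := hF.map _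
  have hprod : F.map (algebraMap ℤ S) = ∏ i, (X - C (θ i)) := by
    refine eq_prod_X_sub_C_of_injective hFmon (by rw [hF.natDegree_map, hr]) θ hinj fun i => ?_
    rw [IsRoot.def, eval_map_algebraMap]
    exact hrooti i
  refine ⟨θ, hprod, ?_⟩
  -- `φ` maps the last root to a root with the residue `α ^ 2 ^ r = α` of the initial one.
  have hcycle : φ^[r] θ₀ = θ₀ := by
    have h1 : (∏ i, (X - C (θ i))).eval (φ^[r] θ₀) = 0 := by
      rw [← hprod, eval_map_algebraMap]; exact hrooti r
    rw [eval_prod, Finset.prod_eq_zero_iff] at h1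
    obtain ⟨i, -, hi⟩ := h1
    have hi' : φ^[r] θ₀ = φ^[i] θ₀ := by
      simpa [θ, sub_eq_zero] using hi
    by_cases hi0 : (i : ℕ) = 0
    · simpa [hi0] using hi'
    · have h3 := congrArg q hi'
      rw [hqi, hqi] at h3
      have := eq_of_pow_two_pow_eq hirr hα i.2.le (by omega) h3.symm
      omega
  have hφθ (i : Fin r) : φ (θ i) = θ (finRotate r i) := by
    obtain ⟨m, rfl⟩ : ∃ m, r = m + 1 := ⟨r - 1, by omega⟩
    rcases eq_or_ne i (Fin.last m) with rfl | hi
    · rw [finRotate_last]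
      simp only [θ, Fin.val_last, Fin.val_zero, Function.iterate_zero, id]
      rw [← Function.iterate_succ_apply' φ, hcycle]
    · have : ((finRotate (m + 1) i : Fin (m + 1)) : ℕ) = i + 1 :=
        coe_finRotate_of_ne_last hi
      simp only [θ, this]
      rw [← Function.iterate_succ_apply' φ]
  have := Equiv.Perm.prod_Ioi_comp_eq_sign_mul_prod (finRotate r)
    (f := fun i j => θ i - θ j) (fun i j => by ring)
  rw [sign_finRotate_of_even hreven hr0] at this
  simp only [map_prod, map_sub, hφθ]
  rw [this]
  simp

/-- If the degree is divisible by `4`, the square of `∏_{i<j} (θ i - θ j)` is the product of the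
values of the derivative at the roots: the number of pairs `i < j` is even. -/
theorem prod_sub_sq_eq_prod_derivative {S : Type*} [CommRing S] [IsDomain S] {r : ℕ} (hr : 4 ∣ r)
    (θ : Fin r → S) :
    (∏ i, ∏ j ∈ Finset.Ioi i, (θ i - θ j)) ^ 2 =
      ∏ i, (derivative (∏ i, (X - C (θ i)))).eval (θ i) := by
  have h1 (i : Fin r) : (derivative (∏ i, (X - C (θ i)))).eval (θ i) =
      ∏ j ∈ {i}ᶜ, (θ i - θ j) := by
    rw [derivative_prod_finset, eval_finsetSum, Finset.sum_eq_single i]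
    · simp [eval_prod, Finset.compl_eq_univ_sdiff, Finset.sdiff_singleton_eq_erase]
    · intro j _ hj
      simp only [derivative_sub, derivative_X, derivative_C, sub_zero, mul_one, eval_prod]
      exact Finset.prod_eq_zero (Finset.mem_erase.2 ⟨hj.symm, Finset.mem_univ i⟩) (by simp)
    · simp
  simp_rw [h1]
  rw [← Finset.prod_prod_Ioi_mul_eq_prod_prod_off_diag (fun j i => θ i - θ j)]
  have h2 (i j : Fin r) : (θ i - θ j) * (θ j - θ i) = (-1) * (θ i - θ j) ^ 2 := by ring
  simp_rw [h2, Finset.prod_mul_distrib, Finset.prod_pow, Finset.prod_const, Fin.card_Ioi,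
    Finset.prod_pow_eq_pow_sum]
  have h3 : Even (∑ i : Fin r, (r - 1 - (i : ℕ))) := by
    rw [← Finset.sum_range (fun i => r - 1 - i), Finset.sum_range_reflect (fun i => i) r,
      Finset.sum_range_id]
    obtain ⟨t, rfl⟩ := hr
    exact ⟨t * (4 * t - 1), by
      rw [show 4 * t * (4 * t - 1) = (t * (4 * t - 1) + t * (4 * t - 1)) * 2 by ring]; simp⟩
  rw [h3.neg_one_pow, one_mul]

/-! ### Mersenne prime polynomials do not have degree divisible by `8` -/

/-- In the ring of integers of a Galois number field, some automorphism lifts the Frobenius map of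
the residue field of a prime above `2`. -/
theorem exists_frobenius_lift (L : Type*) [Field L] [NumberField L] [IsGalois ℚ L] :
    ∃ (𝔪 : Ideal (NumberField.RingOfIntegers L))
      (φ : NumberField.RingOfIntegers L →+* NumberField.RingOfIntegers L),
      𝔪.IsMaximal ∧ 2 ∈ 𝔪 ∧ ∀ x, φ x - x ^ 2 ∈ 𝔪 := by
  let S := NumberField.RingOfIntegers L
  have hmax : (Ideal.span {(2 : ℤ)}).IsMaximal :=
    PrincipalIdealRing.isMaximal_of_irreducible Int.prime_two.irreducible
  obtain ⟨𝔪, h𝔪, hover⟩ := Ideal.exists_ideal_over_maximal_of_isIntegral (S := S)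
    (Ideal.span {(2 : ℤ)}) (by
      rw [(RingHom.injective_iff_ker_eq_bot _).1 (FaithfulSMul.algebraMap_injective ℤ S)]
      exact bot_le)
  have hunder : 𝔪.under ℤ = Ideal.span {(2 : ℤ)} := hover
  have h2 : (2 : S) ∈ 𝔪 := by
    have : (2 : ℤ) ∈ 𝔪.under ℤ := hunder ▸ Ideal.mem_span_singleton_self 2
    simpa [Ideal.under] using this
  have hne : 𝔪 ≠ ⊥ := by
    rintro rfl
    exact two_ne_zero (α := S) ((Ideal.mem_bot).1 h2)
  have : Finite (S ⧸ 𝔪) := Ideal.finiteQuotientOfFreeOfNeBot 𝔪 hne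
  have : Algebra.IsInvariant ℤ S (S ≃ₐ[ℤ] S) := Algebra.isInvariant_of_isGalois' ℤ ℚ L S
  have : Finite (S ≃ₐ[ℤ] S) := Finite.of_equiv _ (galRestrict ℤ ℚ L S).toEquiv
  obtain ⟨σ, hσ⟩ := IsArithFrobAt.exists_of_isInvariant ℤ (S ≃ₐ[ℤ] S) 𝔪
  refine ⟨𝔪, (σ : S →+* S), h𝔪, h2, fun x => ?_⟩
  have hcard : Nat.card (ℤ ⧸ 𝔪.under ℤ) = 2 := by
    rw [hunder]
    refine (Nat.card_congr (Int.quotientSpanNatEquivZMod 2).toEquiv).trans (Nat.card_zmod 2)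
  have := hσ x
  rw [hcard] at this
  exact this

/-- The integral lift of a polynomial `1 + x ^ c * (x + 1) ^ d`. -/
noncomputable def mersenneLift (c d : ℕ) : ℤ[X] := 1 + X ^ c * (X + 1) ^ d

theorem monic_X_pow_mul {R : Type*} [CommRing R] [Nontrivial R] (c d : ℕ) :
    (X ^ c * (X + 1) ^ d : R[X]).Monic ∧ (X ^ c * (X + 1) ^ d : R[X]).natDegree = c + d := by
  have hX : (X + 1 : R[X]).Monic := by simpa using monic_X_add_C (1 : R)
  refine ⟨(monic_X_pow c).mul (hX.pow d), ?_⟩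
  rw [(monic_X_pow c).natDegree_mul (hX.pow d), natDegree_X_pow, hX.natDegree_pow,
    ← C_1, natDegree_X_add_C, mul_one]

theorem monic_one_add_X_pow_mul {R : Type*} [CommRing R] [Nontrivial R] {c d : ℕ} (h : 0 < c + d) :
    (1 + X ^ c * (X + 1) ^ d : R[X]).Monic ∧
      (1 + X ^ c * (X + 1) ^ d : R[X]).natDegree = c + d := by
  obtain ⟨h1, h2⟩ := monic_X_pow_mul (R := R) c d
  have hdeg : (1 : R[X]).degree < (X ^ c * (X + 1) ^ d : R[X]).degree := by
    rw [degree_one, degree_eq_natDegree h1.ne_zero, h2]; exact_mod_cast h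
  exact ⟨h1.add_of_right hdeg, by rw [natDegree_add_eq_right_of_degree_lt hdeg, h2]⟩

/-- `F' = x ^ (c - 1) (x + 1) ^ (d - 1) ((c + d) x + c)` for `F = 1 + x ^ c (x + 1) ^ d`. -/
theorem eval_derivative_mersenneLift {S : Type*} [CommRing S] (c d : ℕ) (x : S) :
    (derivative ((mersenneLift (c + 1) (d + 1)).map (algebraMap ℤ S))).eval x =
      x ^ c * (x + 1) ^ d * ((c + d + 2) * x + (c + 1)) := by
  simp only [mersenneLift, Polynomial.map_add, Polynomial.map_one, Polynomial.map_mul,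
    Polynomial.map_pow, map_X, derivative_one, derivative_mul, derivative_pow,
    derivative_X, eval_add, eval_mul, eval_pow, eval_X, eval_one, eval_zero,
    Nat.add_sub_cancel, Nat.cast_add, Nat.cast_one, map_add, map_natCast, map_one,
    eval_natCast]
  ring

/-- For `8 ∣ r = c + d` with `c` odd the discriminant is `≡ c ^ r ≡ 1` modulo `8`. -/
theorem prod_derivative_mersenneLift {S : Type*} [CommRing S] {c d : ℕ}
    (hc : Even c) (h8 : 8 ∣ c + d + 2) {r : ℕ} (hr : Even r) (θ : Fin r → S)
    (hθ : (mersenneLift (c + 1) (d + 1)).map (algebraMap ℤ S) = ∏ i, (X - C (θ i))) :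
    ∃ ρ : S, ∏ i, (derivative ((mersenneLift (c + 1) (d + 1)).map (algebraMap ℤ S))).eval (θ i) =
      1 + 8 * ρ := by
  have h0 : ∏ i, θ i = 1 := by
    have := congrArg (eval 0) hθ
    simpa [mersenneLift, eval_prod, Finset.prod_neg, hr.neg_one_pow] using this.symm
  have h1 : ∏ i, (θ i + 1) = 1 := by
    have := congrArg (eval (-1)) hθ
    rw [eval_prod] at this
    simp only [eval_sub, eval_X, eval_C] at this
    have h : ∏ i, (-1 - θ i) = ∏ i, (θ i + 1) := by
      rw [Finset.prod_congr rfl fun i _ => show -1 - θ i = -1 * (θ i + 1) by ring,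
        Finset.prod_mul_distrib, Finset.prod_const, Finset.card_univ, Fintype.card_fin,
        hr.neg_one_pow, one_mul]
    rw [← h, ← this]
    simp [mersenneLift]
  simp_rw [eval_derivative_mersenneLift, Finset.prod_mul_distrib, Finset.prod_pow, h0, h1]
  obtain ⟨t, ht⟩ := h8
  have ht' : (c + d + 2 : S) = 8 * t := by exact_mod_cast congrArg (Nat.cast (R := S)) ht
  have hmod : Ideal.Quotient.mk (Ideal.span {(8 : S)}) (∏ i, ((c + d + 2) * θ i + (c + 1))) =
      Ideal.Quotient.mk (Ideal.span {(8 : S)}) 1 := by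
    have h8 : Ideal.Quotient.mk (Ideal.span {(8 : S)}) 8 = 0 :=
      Ideal.Quotient.eq_zero_iff_mem.2 (Ideal.mem_span_singleton_self 8)
    obtain ⟨u, rfl⟩ := hr
    obtain ⟨s, hs⟩ : ∃ s, (c + 1) ^ 2 = 8 * s + 1 := by
      obtain ⟨e, rfl⟩ := hc
      obtain ⟨g, hg⟩ := Nat.even_mul_succ_self e
      exact ⟨g, by linear_combination 4 * hg⟩
    have hs' : ((c + 1) ^ 2 : S) = 8 * s + 1 := by exact_mod_cast congrArg (Nat.cast (R := S)) hs
    have hpow : Ideal.Quotient.mk (Ideal.span {(8 : S)}) ((c + 1) ^ 2) = 1 := by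
      rw [hs', map_add, map_mul, h8]; simp
    rw [map_prod]
    simp_rw [ht', map_add, map_mul, h8]
    simp only [zero_mul, zero_add, Finset.prod_const, Finset.card_univ, Fintype.card_fin]
    rw [← two_mul, pow_mul, ← map_add, ← map_pow, hpow, one_pow, map_one]
  rw [Ideal.Quotient.eq, Ideal.mem_span_singleton] at hmod
  obtain ⟨ρ, hρ⟩ := hmod
  exact ⟨ρ, by rw [one_pow, one_pow, one_mul, one_mul, ← hρ]; ring⟩

/-- Swan's parity theorem for these polynomials: an irreducible `1 + x ^ c (x + 1) ^ d` over `𝔽₂`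
does not have degree divisible by `8`. -/
theorem not_eight_dvd_of_irreducible {c d : ℕ} (hc : 0 < c) (hd : 0 < d)
    (hirr : Irreducible (1 + X ^ c * (X + 1) ^ d : (ZMod 2)[X])) : ¬ 8 ∣ c + d := by
  intro h8
  obtain ⟨c, rfl⟩ : ∃ k, c = k + 1 := ⟨c - 1, by omega⟩
  obtain ⟨d, rfl⟩ : ∃ k, d = k + 1 := ⟨d - 1, by omega⟩
  have hceven : Even c := by
    by_contra hodd
    -- otherwise both exponents are even and the polynomial is a square
    obtain ⟨s, hs⟩ : Even (c + 1) := (Nat.not_even_iff_odd.1 hodd).add_one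
    obtain ⟨t, ht⟩ : Even (d + 1) := by
      rw [Nat.even_iff]; omega
    have hsq : (1 + X ^ (c + 1) * (X + 1) ^ (d + 1) : (ZMod 2)[X]) =
        (1 + X ^ s * (X + 1) ^ t) * (1 + X ^ s * (X + 1) ^ t) := by
      rw [hs, ht, ← sq (1 + X ^ s * (X + 1) ^ t), add_sq]
      linear_combination (-X ^ s * (X + 1) ^ t) * CharTwo.two_eq_zero (R := (ZMod 2)[X])
    rw [hsq] at hirr
    have h1 := monic_one_add_X_pow_mul (R := ZMod 2) (c := s) (d := t) (by omega)
    rcases hirr.isUnit_or_isUnit rfl with h | h <;>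
    · have := natDegree_eq_zero_of_isUnit h
      omega
  set F := mersenneLift (c + 1) (d + 1) with hF
  obtain ⟨hmon, hdeg⟩ : F.Monic ∧ F.natDegree = c + 1 + (d + 1) :=
    monic_one_add_X_pow_mul (by omega)
  have hr8 : 8 ∣ F.natDegree := hdeg ▸ h8
  have hrirr : Irreducible (F.map (Int.castRingHom (ZMod 2))) := by
    simpa [hF, mersenneLift] using hirr
  let G : ℚ[X] := F.map (algebraMap ℤ ℚ)
  let L := G.SplittingField
  have : NumberField L := { to_charZero := charZero_of_injective_algebraMap
                              (algebraMap ℚ L).injective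
                            to_finiteDimensional := inferInstance }
  have hGirr : Irreducible G := (hmon.irreducible_iff_irreducible_map_fraction_map (K := ℚ)).1
    (hmon.irreducible_of_irreducible_map _ _ hrirr)
  have : IsSplittingField ℚ L G := IsSplittingField.splittingField G
  have : IsGalois ℚ L := IsGalois.of_separable_splitting_field hGirr.separable
  obtain ⟨𝔪, φ, h𝔪, h2, hφ⟩ := exists_frobenius_lift L
  obtain ⟨x, hx⟩ := Splits.exists_eval_eq_zero (SplittingField.splits G) (by
    rw [degree_map, degree_eq_natDegree (hmon.map _).ne_zero, hmon.natDegree_map]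
    exact_mod_cast (by omega : F.natDegree ≠ 0))
  have hx' : aeval x F = 0 := by
    rwa [eval_map_algebraMap, aeval_map_algebraMap] at hx
  obtain ⟨θ₀, rfl⟩ : ∃ θ₀ : NumberField.RingOfIntegers L, (θ₀ : L) = x :=
    ⟨⟨x, F, hmon, hx'⟩, rfl⟩
  have hθ₀ : aeval θ₀ F = 0 := by
    have := aeval_algebraMap_apply L θ₀ F
    rw [hx'] at this
    exact (map_eq_zero_iff _ (FaithfulSMul.algebraMap_injective _ _)).1 this.symm
  have hreven : Even F.natDegree := by rw [even_iff_two_dvd]; omega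
  obtain ⟨θ, hθ, hneg⟩ := exists_roots_frobenius_neg h2 φ hφ hmon hrirr rfl hreven hθ₀
  have hsq := prod_sub_sq_eq_prod_derivative (by omega) θ
  rw [← hθ] at hsq
  obtain ⟨ρ, hρ⟩ := prod_derivative_mersenneLift hceven (by omega) hreven θ hθ
  rw [hρ] at hsq
  set δ := ∏ i, ∏ j ∈ Finset.Ioi i, (θ i - θ j)
  -- `(δ - 1) / 2` is an algebraic integer, as a root of `X² + X - 2ρ`
  obtain ⟨γ, hγ⟩ : ∃ γ, 2 * γ + 1 = δ := by
    have hint : IsIntegral (NumberField.RingOfIntegers L) (((δ : L) - 1) / 2) := by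
      refine ⟨X ^ 2 + X - C (2 * ρ), by monicity!, ?_⟩
      have hL : (δ : L) ^ 2 = 1 + 8 * ρ := by
        have := congrArg (algebraMap _ L) hsq
        simpa only [map_pow, map_add, map_one, map_mul, map_ofNat] using this
      simp only [eval₂_sub, eval₂_add, eval₂_X_pow, eval₂_X, eval₂_C]
      rw [map_mul, map_ofNat]
      linear_combination hL / 4
    obtain ⟨γ, hγ⟩ := IsIntegrallyClosed.algebraMap_eq_of_integral hint
    refine ⟨γ, FaithfulSMul.algebraMap_injective _ L ?_⟩
    rw [map_add, map_mul, hγ]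
    simp only [map_ofNat, map_one]
    ring
  have hγsq : γ ^ 2 + γ = 2 * ρ := by
    have : (4 : NumberField.RingOfIntegers L) ≠ 0 := by norm_num
    apply mul_left_cancel₀ this
    rw [← hγ] at hsq
    linear_combination hsq
  have hφγ : φ γ = -1 - γ := by
    have : (2 : NumberField.RingOfIntegers L) ≠ 0 := by norm_num
    apply mul_left_cancel₀ this
    rw [← hγ] at hneg
    simp only [map_add, map_mul, map_ofNat, map_one] at hneg
    linear_combination hneg
  have h1 : (1 : NumberField.RingOfIntegers L) ∈ 𝔪 := by
    have h3 := hφ γ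
    rw [hφγ] at h3
    have h4 : (1 : NumberField.RingOfIntegers L) = -(-1 - γ - γ ^ 2) - 2 * ρ := by
      rw [← hγsq]; ring
    rw [h4]
    exact 𝔪.sub_mem (𝔪.neg_mem h3) (𝔪.mul_mem_right _ h2)
  exact h𝔪.ne_top ((Ideal.eq_top_iff_one _).2 h1)

/-! ### The sum of divisors of a product of prime powers -/

theorem eq_one_of_ne_zero (c : ZMod 2) (h : c ≠ 0) : c = 1 := by
  revert c; decide

theorem monic_of_ne_zero {A : (ZMod 2)[X]} (h : A ≠ 0) : A.Monic :=
  eq_one_of_ne_zero _ (leadingCoeff_ne_zero.2 h)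

theorem eq_of_associated {A B : (ZMod 2)[X]} (h : Associated A B) : A = B := by
  rcases eq_or_ne A 0 with rfl | hA
  · exact (associated_zero_iff_eq_zero B).1 h.symm |>.symm
  · exact eq_of_monic_of_associated (monic_of_ne_zero hA)
      (monic_of_ne_zero (h.ne_zero_iff.1 hA)) h

theorem eq_of_irreducible_of_dvd {P Q : (ZMod 2)[X]} (hP : Irreducible P) (hQ : Irreducible Q)
    (h : P ∣ Q) : P = Q :=
  eq_of_associated (hP.associated_of_dvd hQ h)

theorem sigma_one : sigma 1 = 1 := by
  have : {d : (ZMod 2)[X] | d ∣ 1} = {1} := by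
    ext d
    simp only [Set.mem_ofPred_eq, Set.mem_singleton_iff]
    exact ⟨fun h => eq_of_associated (associated_one_iff_isUnit.2 (isUnit_of_dvd_one h)), fun h => h ▸ dvd_rfl⟩
  rw [sigma, this, finsum_mem_singleton]

theorem sigma_mul {A B : (ZMod 2)[X]} (hA : A ≠ 0) (hB : B ≠ 0) (h : IsCoprime A B) :
    sigma (A * B) = sigma A * sigma B := by
  classical
  have hfA := finite_divisors hA
  have hfB := finite_divisors hB
  have hfAB := finite_divisors (mul_ne_zero hA hB)
  have hs : ∀ {C : (ZMod 2)[X]} (hC : {d : (ZMod 2)[X] | d ∣ C}.Finite),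
      sigma C = ∑ d ∈ hC.toFinset, d := fun hC => finsum_mem_eq_finite_toFinset_sum _ hC
  rw [hs hfA, hs hfB, hs hfAB, Finset.sum_mul_sum, ← Finset.sum_product']
  symm
  refine Finset.sum_bij (fun p _ => p.1 * p.2) ?_ ?_ ?_ fun _ _ => rfl
  · rintro ⟨d, e⟩ hp
    simp only [Finset.mem_product, Set.Finite.mem_toFinset, Set.mem_ofPred_eq] at hp ⊢
    exact mul_dvd_mul hp.1 hp.2
  · rintro ⟨d, e⟩ hp ⟨d', e'⟩ hp' heq
    simp only [Finset.mem_product, Set.Finite.mem_toFinset, Set.mem_ofPred_eq] at hp hp' heq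
    have cop {x y : (ZMod 2)[X]} (hx : x ∣ A) (hy : y ∣ B) : IsCoprime x y :=
      h.of_isCoprime_of_dvd_left hx |>.of_isCoprime_of_dvd_right hy
    have h1 : d = d' := eq_of_associated <| associated_of_dvd_dvd
      ((cop hp.1 hp'.2).dvd_of_dvd_mul_right (Dvd.intro _ heq))
      ((cop hp'.1 hp.2).dvd_of_dvd_mul_right (Dvd.intro _ heq.symm))
    subst h1
    rw [mul_left_cancel₀ (ne_zero_of_dvd_ne_zero hA hp.1) heq]
  · intro d hd
    simp only [Set.Finite.mem_toFinset, Set.mem_ofPred_eq] at hd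
    obtain ⟨x, y, hx, hy, rfl⟩ := exists_dvd_and_dvd_of_dvd_mul hd
    exact ⟨(x, y), by simp [hx, hy], rfl⟩

theorem sigma_pow {P : (ZMod 2)[X]} (hP : Irreducible P) (k : ℕ) :
    sigma (P ^ k) = ∑ i ∈ Finset.range (k + 1), P ^ i := by
  have hset : {d : (ZMod 2)[X] | d ∣ P ^ k} = (fun i => P ^ i) '' (Finset.range (k + 1) : Set ℕ) := by
    ext d
    simp only [Set.mem_ofPred_eq, Set.mem_image, Finset.coe_range, Set.mem_Iio]
    constructor
    · intro hd
      obtain ⟨i, hi, h⟩ := (dvd_prime_pow hP.prime k).1 hd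
      exact ⟨i, by omega, (eq_of_associated h).symm⟩
    · rintro ⟨i, hi, rfl⟩
      exact pow_dvd_pow P (by omega)
  rw [sigma, hset, finsum_mem_image, finsum_mem_coe_finset]
  exact (pow_injective_of_not_isUnit hP.not_isUnit hP.ne_zero).injOn

theorem sigma_prod {ι : Type*} (s : Finset ι) (P : ι → (ZMod 2)[X]) (hinj : Set.InjOn P s)
    (hP : ∀ i ∈ s, Irreducible (P i)) (e : ι → ℕ) :
    sigma (∏ i ∈ s, P i ^ e i) = ∏ i ∈ s, ∑ k ∈ Finset.range (e i + 1), P i ^ k := by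
  classical
  induction s using Finset.induction_on with
  | empty => simpa using sigma_one
  | insert a s ha ih =>
    rw [Finset.prod_insert ha, Finset.prod_insert ha, sigma_mul, sigma_pow, ih]
    · exact hinj.mono (by simp)
    · exact fun i hi => hP i (by simp [hi])
    · exact hP a (by simp)
    · exact pow_ne_zero _ (hP a (by simp)).ne_zero
    · exact Finset.prod_ne_zero_iff.2 fun i hi => pow_ne_zero _ (hP i (by simp [hi])).ne_zero
    · refine IsCoprime.prod_right fun i hi => IsCoprime.pow ?_
      refine ((hP a (by simp)).coprime_iff_not_dvd).2 fun hdvd => ?_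
      have := hinj (by simp) (by simp [hi])
        (eq_of_irreducible_of_dvd (hP a (by simp)) (hP i (by simp [hi])) hdvd)
      exact ha (this ▸ hi)

/-! ### Leading coefficients of `σ(A)` -/

theorem degree_sum_pow_sub_pow {P : (ZMod 2)[X]} {m : ℕ} (hP : m ≤ P.natDegree) (hP0 : P ≠ 0)
    (k : ℕ) : (∑ i ∈ Finset.range (k + 1), P ^ i - P ^ k).degree + m ≤ (P ^ k).degree := by
  rw [Finset.sum_range_succ, add_sub_cancel_right]
  rcases k with _ | k
  · simp
  have hdeg (i : ℕ) : (P ^ i).degree = (i * P.natDegree : ℕ) := by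
    rw [degree_eq_natDegree (pow_ne_zero _ hP0), natDegree_pow]
  calc (∑ i ∈ Finset.range (k + 1), P ^ i).degree + m ≤ ((k * P.natDegree : ℕ) : WithBot ℕ) + m := by
        gcongr
        refine (degree_sum_le _ _).trans (Finset.sup_le fun i hi => ?_)
        rw [hdeg]
        have : i ≤ k := by simpa [Nat.lt_succ_iff] using hi
        exact_mod_cast Nat.mul_le_mul_right _ this
    _ ≤ (P ^ (k + 1)).degree := by
        rw [hdeg]
        norm_cast
        rw [Nat.succ_mul]; omega

/-- The relation `deg (B - A) + m ≤ deg A` is multiplicative. -/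
theorem degree_mul_sub_mul_add_le {A B A' B' : (ZMod 2)[X]} {m : ℕ}
    (h : (B - A).degree + m ≤ A.degree) (h' : (B' - A').degree + m ≤ A'.degree) :
    (B * B' - A * A').degree + m ≤ (A * A').degree := by
  have hB : B'.degree ≤ A'.degree := by
    have : B' = (B' - A') + A' := by ring
    rw [this]
    refine (degree_add_le _ _).trans (max_le (le_trans ?_ h') le_rfl)
    exact le_add_of_nonneg_right (by exact_mod_cast Nat.zero_le m)
  have : B * B' - A * A' = (B - A) * B' + A * (B' - A') := by ring
  rw [this, degree_mul]
  refine (add_le_add_left (degree_add_le _ _) _).trans ?_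
  rw [max_add]
  refine max_le ?_ ?_
  · rw [degree_mul, add_right_comm]
    exact add_le_add h hB
  · rw [degree_mul, add_assoc]
    exact add_le_add le_rfl h'

theorem degree_prod_sum_pow_sub_prod_pow {ι : Type*} (s : Finset ι) (P : ι → (ZMod 2)[X]) {m : ℕ}
    (hP : ∀ i ∈ s, m ≤ (P i).natDegree) (hP0 : ∀ i ∈ s, P i ≠ 0) (e : ι → ℕ) :
    (∏ i ∈ s, ∑ k ∈ Finset.range (e i + 1), P i ^ k - ∏ i ∈ s, P i ^ e i).degree + m ≤
      (∏ i ∈ s, P i ^ e i).degree := by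
  classical
  induction s using Finset.induction_on with
  | empty => simp
  | insert a s ha ih =>
    rw [Finset.prod_insert ha, Finset.prod_insert ha]
    refine degree_mul_sub_mul_add_le ?_ (ih (fun i hi => hP i (by simp [hi]))
      fun i hi => hP0 i (by simp [hi]))
    exact degree_sum_pow_sub_pow (hP a (by simp)) (hP0 a (by simp)) (e a)

/-- A product of powers of distinct irreducible polynomials exactly one of which, with positive
exponent, has the minimal degree `m`, is not perfect: the coefficient at distance `m` from the top
changes under `σ` (which is the left-hand side, by `sigma_prod`). -/
theorem prod_sum_pow_ne_of_unique_min_degree {ι : Type*} [DecidableEq ι] (s : Finset ι)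
    (P : ι → (ZMod 2)[X]) {m : ℕ} {a : ι} (ha : a ∈ s) (hPa : (P a).natDegree = m) (hm : 0 < m)
    (hP : ∀ i ∈ s, i ≠ a → m + 1 ≤ (P i).natDegree) {e : ι → ℕ} (he : e a ≠ 0) :
    ∏ i ∈ s, ∑ k ∈ Finset.range (e i + 1), P i ^ k ≠ ∏ i ∈ s, P i ^ e i := by
  have hP0 : ∀ i ∈ s, P i ≠ 0 := by
    rintro i hi h0
    rcases eq_or_ne i a with rfl | hia
    · rw [h0, natDegree_zero] at hPa; omega
    · have := hP i hi hia
      rw [h0, natDegree_zero] at this; omega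
  intro heq
  rw [← Finset.mul_prod_erase s _ ha, ← Finset.mul_prod_erase s _ ha] at heq
  have hB := degree_prod_sum_pow_sub_prod_pow (s.erase a) P (m := m + 1)
    (fun i hi => hP i (Finset.mem_of_mem_erase hi) (Finset.ne_of_mem_erase hi))
    (fun i hi => hP0 i (Finset.mem_of_mem_erase hi)) e
  set B := ∏ i ∈ s.erase a, P i ^ e i with hBdef
  set B' := ∏ i ∈ s.erase a, ∑ k ∈ Finset.range (e i + 1), P i ^ k
  have hB0 : B ≠ 0 := Finset.prod_ne_zero_iff.2 fun i hi =>
    pow_ne_zero _ (hP0 i (Finset.mem_of_mem_erase hi))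
  obtain ⟨k, hk⟩ := Nat.exists_eq_succ_of_ne_zero he
  have ha0 := hP0 a ha
  rw [hk, Finset.sum_range_succ] at heq
  set T := ∑ i ∈ Finset.range (k + 1), P a ^ i with hT
  have hTdeg : T.degree = (k * m : ℕ) := by
    have h1 := degree_sum_pow_sub_pow hPa.ge ha0 k
    have h2 : (P a ^ k).degree = (k * m : ℕ) := by
      rw [degree_eq_natDegree (pow_ne_zero _ ha0), natDegree_pow, hPa]
    rw [← hT, h2] at h1
    have h3 : (T - P a ^ k).degree < (P a ^ k).degree := by
      rw [h2]
      by_cases hz : T - P a ^ k = 0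
      · rw [hz, degree_zero]; exact WithBot.bot_lt_coe _
      · rw [degree_eq_natDegree hz] at h1 ⊢
        set d := (T - P a ^ k).natDegree
        have h1' : d + m ≤ k * m := by exact_mod_cast h1
        exact_mod_cast (show d < k * m by omega)
    rw [← h2, ← degree_add_eq_right_of_degree_lt h3, sub_add_cancel]
  have hP' : (P a ^ (k + 1)).degree = ((k + 1) * m : ℕ) := by
    rw [degree_eq_natDegree (pow_ne_zero _ ha0), natDegree_pow, hPa]
  -- `σ(A) - A = T * B + (T + P a ^ (k + 1)) * (B' - B)`, where the first term dominates
  have hsum : T * B = -((T + P a ^ (k + 1)) * (B' - B)) := by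
    rw [Nat.succ_eq_add_one] at heq
    linear_combination heq
  have hdegsum : (T + P a ^ (k + 1)).degree = ((k + 1) * m : ℕ) := by
    rw [degree_add_eq_right_of_degree_lt, hP']
    rw [hTdeg, hP']
    exact_mod_cast (show k * m < (k + 1) * m by rw [Nat.succ_mul]; omega)
  have hd := congrArg degree hsum
  rw [degree_neg, degree_mul, degree_mul, hdegsum, hTdeg] at hd
  rw [degree_eq_natDegree hB0] at hd hB
  by_cases hz : B' - B = 0
  · rw [hz, degree_zero, WithBot.add_bot] at hd
    exact WithBot.coe_ne_bot hd
  · rw [degree_eq_natDegree hz] at hd hB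
    set d := (B' - B).natDegree
    have hd1 : k * m + B.natDegree = (k + 1) * m + d := by exact_mod_cast hd
    have hB1 : d + (m + 1) ≤ B.natDegree := by exact_mod_cast hB
    rw [Nat.succ_mul] at hd1
    omega

/-! ### Mersenne numbers `2 ^ n - 1` and the field of `2 ^ n` elements -/

/-- Every element outside `𝔽₂` of a finite field `K` of characteristic `2` is a root of `P` or of
`Φ_p(P) = 1 + P + ⋯ + P ^ (p - 1)`, for `p = |K| - 1` and `P = 1 + x ^ a (x + 1) ^ b`: the value of
`P - 1` is a nonzero element of `K`, so that of `P` differs from `1`. -/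
theorem aeval_eq_zero_or_geom_sum_aeval_eq_zero {K : Type*} [Field K] [Fintype K]
    [Algebra (ZMod 2) K] (a b : ℕ) {α : K} (h0 : α ≠ 0) (h1 : α + 1 ≠ 0) :
    aeval α (1 + X ^ a * (X + 1) ^ b : (ZMod 2)[X]) = 0 ∨
      aeval α (∑ i ∈ Finset.range (Fintype.card K - 1),
        (1 + X ^ a * (X + 1) ^ b : (ZMod 2)[X]) ^ i) = 0 := by
  set P := (1 + X ^ a * (X + 1) ^ b : (ZMod 2)[X])
  refine or_iff_not_imp_left.2 fun hP => ?_
  have hP1 : aeval α P - 1 ≠ 0 := by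
    simp only [P, map_add, map_one, map_mul, map_pow, aeval_X, add_sub_cancel_left]
    exact mul_ne_zero (pow_ne_zero _ h0) (pow_ne_zero _ h1)
  apply mul_right_cancel₀ hP1
  simp only [map_sum, map_pow]
  rw [geom_sum_mul, zero_mul, FiniteField.pow_card_sub_one_eq_one _ hP, sub_self]

theorem add_one_ne_zero_of_ne_one {K : Type*} [Field K] [Algebra (ZMod 2) K] {α : K} (h : α ≠ 1) :
    α + 1 ≠ 0 := by
  have : CharP K 2 := charP_of_injective_algebraMap (algebraMap (ZMod 2) K).injective 2
  intro h0
  exact h (CharTwo.add_eq_zero.1 h0)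

/-- The minimal polynomial of an element outside `𝔽₂` of a field of `2 ^ n` elements divides
`P` or `Φ_(2 ^ n - 1)(P)`. -/
theorem minpoly_dvd_or_dvd_geom_sum {n : ℕ} (hn : n ≠ 0) {P : (ZMod 2)[X]} (hP : IsMersennePrime P)
    {α : GaloisField 2 n} (h0 : α ≠ 0) (h1 : α ≠ 1) :
    minpoly (ZMod 2) α ∣ P ∨ minpoly (ZMod 2) α ∣ ∑ i ∈ Finset.range (mersenne n), P ^ i := by
  obtain ⟨-, a, b, -, -, rfl⟩ := hP
  have := Fintype.ofFinite (GaloisField 2 n)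
  have hcard : Fintype.card (GaloisField 2 n) = 2 ^ n := by
    rw [← Nat.card_eq_fintype_card, GaloisField.card 2 n hn]
  rcases aeval_eq_zero_or_geom_sum_aeval_eq_zero a b h0 (add_one_ne_zero_of_ne_one h1) with h | h
  · exact Or.inl (minpoly.dvd _ _ h)
  · rw [hcard] at h
    exact Or.inr (minpoly.dvd _ _ h)

theorem natDegree_minpoly_galoisField {n : ℕ} (hn : n.Prime) {α : GaloisField 2 n}
    (h0 : α ≠ 0) (h1 : α ≠ 1) : (minpoly (ZMod 2) α).natDegree = n := by
  have hdvd := minpoly.degree_dvd (K := ZMod 2) (x := α) (.of_finite _ _)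
  rw [GaloisField.finrank 2 hn.ne_zero] at hdvd
  refine ((Nat.dvd_prime hn).1 hdvd).resolve_left fun h => ?_
  obtain ⟨c, hc⟩ := (minpoly.natDegree_eq_one_iff).1 h
  by_cases hc0 : c = 0
  · exact h0 (by rw [← hc, hc0, map_zero])
  · exact h1 (by rw [← hc, eq_one_of_ne_zero c hc0, map_one])

/-- For a prime `n ≥ 5` there are more irreducible polynomials of degree `n` than Mersenne ones, so
that some element of the field of `2 ^ n` elements has a minimal polynomial of another form. -/
theorem exists_not_isMersennePrime_minpoly {n : ℕ} (hn : n.Prime) (h5 : 5 ≤ n) :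
    ∃ α : GaloisField 2 n, α ≠ 0 ∧ α ≠ 1 ∧ ¬ IsMersennePrime (minpoly (ZMod 2) α) := by
  classical
  by_contra! hall
  have := Fintype.ofFinite (GaloisField 2 n)
  have hcard : Fintype.card (GaloisField 2 n) = 2 ^ n := by
    rw [← Nat.card_eq_fintype_card, GaloisField.card 2 n hn.ne_zero]
  let f (c : ℕ) : (GaloisField 2 n)[X] := 1 + X ^ c * (X + 1) ^ (n - c)
  have hsub : (Finset.univ : Finset (GaloisField 2 n)) ⊆
      {0, 1} ∪ (Finset.Ioo 0 n).biUnion fun c => (f c).roots.toFinset := by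
    intro α _
    simp only [Finset.mem_union, Finset.mem_insert, Finset.mem_singleton, Finset.mem_biUnion,
      Finset.mem_Ioo, Multiset.mem_toFinset]
    by_cases h0 : α = 0
    · exact Or.inl (Or.inl h0)
    by_cases h1 : α = 1
    · exact Or.inl (Or.inr h1)
    obtain ⟨-, c, d, hc, hd, hcd⟩ := hall α h0 h1
    have hdeg := natDegree_minpoly_galoisField hn h0 h1
    rw [hcd, (monic_one_add_X_pow_mul (by omega)).2] at hdeg
    refine Or.inr ⟨c, ⟨hc, by omega⟩, ?_⟩
    rw [mem_roots (monic_one_add_X_pow_mul (by omega)).1.ne_zero, IsRoot.def]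
    have := minpoly.aeval (ZMod 2) α
    rw [hcd] at this
    simpa [f, show n - c = d by omega] using this
  have hle := Finset.card_le_card hsub
  have hroots : ((Finset.Ioo 0 n).biUnion fun c => (f c).roots.toFinset).card ≤ (n - 1) * n := by
    refine (Finset.card_biUnion_le_card_mul _ _ n fun c hc => ?_).trans (by simp)
    rw [Finset.mem_Ioo] at hc
    refine (Multiset.toFinset_card_le _).trans ((card_roots' _).trans ?_)
    rw [(monic_one_add_X_pow_mul (by omega)).2]; omega
  rw [Finset.card_univ, hcard] at hle
  have h2 := (Finset.card_union_le ({0, 1} : Finset (GaloisField 2 n))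
    ((Finset.Ioo 0 n).biUnion fun c => (f c).roots.toFinset))
  have h3 := Finset.card_le_two (a := (0 : GaloisField 2 n)) (b := 1)
  have hpow : ∀ k, 5 ≤ k → 2 + (k - 1) * k < 2 ^ k := by
    intro k hk
    induction k, hk using Nat.le_induction with
    | base => norm_num
    | succ k hk ih =>
      obtain ⟨j, rfl⟩ := Nat.exists_eq_add_of_le hk
      rw [pow_succ]
      rw [show 5 + j - 1 = j + 4 by omega] at ih
      rw [show 5 + j + 1 - 1 = j + 5 by omega]
      nlinarith
  have := hpow n h5
  omega

/-! ### Fermat primes -/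

/-- `8` divides the degree of an extension of `𝔽₂` that contains an element of prime order
`2 ^ 2 ^ n + 1` with `n ≥ 2`. -/
theorem eight_dvd_of_fermatNumber_dvd {n r : ℕ} (hp : (Nat.fermatNumber n).Prime) (hn : 2 ≤ n)
    (h : Nat.fermatNumber n ∣ 2 ^ r - 1) : 8 ∣ r := by
  have : Fact (Nat.fermatNumber n).Prime := ⟨hp⟩
  have : Fact (2 < Nat.fermatNumber n) := ⟨Nat.two_lt_fermatNumber n⟩
  have h1 : (2 : ZMod (Nat.fermatNumber n)) ^ 2 ^ n = -1 := by
    rw [eq_neg_iff_add_eq_zero]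
    exact_mod_cast (ZMod.natCast_eq_zero_iff (2 ^ 2 ^ n + 1) (Nat.fermatNumber n)).2 dvd_rfl
  have hord : orderOf (2 : ZMod (Nat.fermatNumber n)) = 2 ^ (n + 1) := by
    apply orderOf_eq_prime_pow
    · rw [h1]; exact ZMod.neg_one_ne_one
    · rw [pow_succ, pow_mul, h1, neg_one_sq]
  have hr : (2 : ZMod (Nat.fermatNumber n)) ^ r = 1 := by
    have := (ZMod.natCast_eq_zero_iff _ _).2 h
    rw [Nat.cast_sub Nat.one_le_two_pow, sub_eq_zero] at this
    exact_mod_cast this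
  rw [← orderOf_dvd_iff_pow_eq_one, hord] at hr
  exact (pow_dvd_pow 2 (show 3 ≤ n + 1 by omega)).trans hr

/-- An irreducible factor of `Φ_p(P)` of degree `r` provides an element of order `p` of the field of
`2 ^ r` elements. -/
theorem dvd_two_pow_sub_one_of_dvd_geom_sum {p : ℕ} (hp : p.Prime) (hp2 : p ≠ 2)
    {P Q : (ZMod 2)[X]} (hQ : Irreducible Q) (h : Q ∣ ∑ i ∈ Finset.range p, P ^ i) :
    p ∣ 2 ^ Q.natDegree - 1 := by
  have : Fact (Irreducible Q) := ⟨hQ⟩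
  have : Fact p.Prime := ⟨hp⟩
  let K := AdjoinRoot Q
  have hfin : Module.Finite (ZMod 2) K := (AdjoinRoot.powerBasis hQ.ne_zero).finite
  have : Finite K := Module.finite_of_finite (ZMod 2)
  have := Fintype.ofFinite K
  have : CharP K 2 := charP_of_injective_algebraMap (algebraMap (ZMod 2) K).injective 2
  have hcard : Fintype.card K = 2 ^ Q.natDegree := by
    rw [Module.card_eq_pow_finrank (K := ZMod 2), ZMod.card,
      (AdjoinRoot.powerBasis hQ.ne_zero).finrank, AdjoinRoot.powerBasis_dim]
  set ζ : K := AdjoinRoot.mk Q P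
  have hsum : ∑ i ∈ Finset.range p, ζ ^ i = 0 := by
    have := AdjoinRoot.mk_eq_zero.2 h
    simpa only [map_sum, map_pow] using this
  have hζp : ζ ^ p = 1 := by
    have := geom_sum_mul ζ p
    rw [hsum, zero_mul] at this
    exact (sub_eq_zero.1 this.symm)
  have hζ1 : ζ ≠ 1 := by
    intro h1
    rw [h1] at hsum
    simp only [one_pow, Finset.sum_const, Finset.card_range, nsmul_eq_mul, mul_one] at hsum
    have := (CharP.cast_eq_zero_iff K 2 p).1 hsum
    exact hp2 ((Nat.prime_dvd_prime_iff_eq Nat.prime_two hp).1 this).symm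
  have hζ0 : ζ ≠ 0 := by
    intro h0
    rw [h0, zero_pow hp.ne_zero] at hζp
    exact zero_ne_one hζp
  rw [← orderOf_eq_prime hζp hζ1, orderOf_dvd_iff_pow_eq_one, ← hcard]
  exact FiniteField.pow_card_sub_one_eq_one ζ hζ0

/-! ### Perfect products of Mersenne prime polynomials -/

theorem IsMersennePrime.two_le_natDegree {P : (ZMod 2)[X]} (hP : IsMersennePrime P) :
    2 ≤ P.natDegree := by
  obtain ⟨-, a, b, ha, hb, rfl⟩ := hP
  rw [(monic_one_add_X_pow_mul (by omega)).2]; omega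

/-- The only Mersenne prime of degree `2` is `x ^ 2 + x + 1`. -/
theorem IsMersennePrime.eq_of_natDegree_eq_two {P Q : (ZMod 2)[X]} (hP : IsMersennePrime P)
    (hQ : IsMersennePrime Q) (hP2 : P.natDegree = 2) (hQ2 : Q.natDegree = 2) : P = Q := by
  obtain ⟨-, a, b, ha, hb, rfl⟩ := hP
  obtain ⟨-, c, d, hc, hd, rfl⟩ := hQ
  rw [(monic_one_add_X_pow_mul (by omega)).2] at hP2 hQ2
  obtain ⟨rfl, rfl, rfl, rfl⟩ : a = 1 ∧ b = 1 ∧ c = 1 ∧ d = 1 := by omega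
  rfl

theorem not_isUnit_geom_sum {P : (ZMod 2)[X]} (hP : 0 < P.natDegree) {p : ℕ} (hp : 2 ≤ p) :
    ¬ IsUnit (∑ i ∈ Finset.range p, P ^ i) := by
  intro hu
  have hne : P - 1 ≠ 0 := by
    intro h0
    rw [sub_eq_zero.1 h0, natDegree_one] at hP
    omega
  have h1 : (P ^ p - 1).natDegree = p * P.natDegree := by
    rw [← C_1, natDegree_sub_C, natDegree_pow]
  have h2 : (P - 1).natDegree = P.natDegree := by rw [← C_1, natDegree_sub_C]
  rw [← geom_sum_mul, natDegree_mul hu.ne_zero hne, natDegree_eq_zero_of_isUnit hu, h2] at h1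
  nlinarith

/-- Every irreducible factor of `Φ_p(P j)` divides `σ(A)`; if `A` is perfect, it is one of the Mersenne
primes `P i` with `h i > 0`. For `p = 3` this forces the factor `x ^ 2 + x + 1`, for larger Mersenne
numbers `p = 2 ^ n - 1` all irreducible polynomials of degree `n` would be Mersenne, and for Fermat
numbers `p ≥ 17` the degree of the factor would be divisible by `8`. -/
theorem not_isPerfect_prod {ι : Type*} [Fintype ι] (P : ι → (ZMod 2)[X]) (h : ι → ℕ)
    (hinj : Function.Injective P) (hP : ∀ j, IsMersennePrime (P j)) {j : ι} {p : ℕ}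
    (hdvd : p ∣ 2 * h j + 1)
    (hp : (IsMersennePrimeNumber p ∧ p ≠ 7) ∨ (IsFermatPrimeNumber p ∧ p ≠ 5)) :
    ¬ IsPerfect (∏ j, P j ^ (2 * h j)) := by
  classical
  rintro ⟨-, hperf⟩
  rw [sigma_prod _ _ hinj.injOn fun i _ => (hP i).1] at hperf
  have hprime : p.Prime := hp.elim (fun h => h.1.1) fun h => h.1.1
  have hgeom : ∑ i ∈ Finset.range p, P j ^ i ∣ ∏ j, P j ^ (2 * h j) := by
    rw [← hperf]
    refine dvd_trans ?_ (Finset.dvd_prod_of_mem _ (Finset.mem_univ j))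
    obtain ⟨t, ht⟩ := hdvd
    have hne : P j - 1 ≠ 0 := by
      intro h0
      have := (hP j).two_le_natDegree
      rw [sub_eq_zero.1 h0, natDegree_one] at this
      omega
    refine (mul_dvd_mul_iff_right hne).1 ?_
    rw [geom_sum_mul, geom_sum_mul, ht, pow_mul]
    exact sub_one_dvd_pow_sub_one _ _
  have hfactor {Q : (ZMod 2)[X]} (hQ : Irreducible Q) (hQd : Q ∣ ∑ i ∈ Finset.range p, P j ^ i) :
      ∃ i, P i = Q ∧ h i ≠ 0 := by
    obtain ⟨i, -, hi⟩ := (hQ.prime.dvd_finsetProd_iff _).1 (hQd.trans hgeom)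
    refine ⟨i, (eq_of_irreducible_of_dvd hQ (hP i).1 (hQ.prime.dvd_of_dvd_pow hi)).symm, ?_⟩
    rintro h0
    rw [h0, mul_zero, pow_zero] at hi
    exact hQ.not_isUnit (isUnit_of_dvd_one hi)
  have hj0 : h j ≠ 0 := by
    intro h0
    rw [h0] at hdvd
    exact hprime.one_lt.ne' (Nat.dvd_one.1 hdvd)
  -- every element outside `𝔽₂` of the field of `2 ^ n` elements is a root of some factor of `A`
  have hmin {n : ℕ} (hn : n.Prime) (hpn : p = mersenne n) {α : GaloisField 2 n} (h0 : α ≠ 0)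
      (h1 : α ≠ 1) : ∃ i, P i = minpoly (ZMod 2) α ∧ h i ≠ 0 := by
    have hirr : Irreducible (minpoly (ZMod 2) α) := minpoly.irreducible (.of_finite _ _)
    rcases minpoly_dvd_or_dvd_geom_sum hn.ne_zero (hP j) h0 h1 with hd | hd
    · exact ⟨j, (eq_of_irreducible_of_dvd hirr (hP j).1 hd).symm, hj0⟩
    · exact hfactor hirr (hpn ▸ hd)
  by_cases hp3 : p = 3
  · obtain ⟨α, hα0, hα1⟩ : ∃ α : GaloisField 2 2, α ≠ 0 ∧ α ≠ 1 := by
      have : 2 < Nat.card (GaloisField 2 2) := by rw [GaloisField.card 2 2 two_ne_zero]; norm_num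
      by_contra! hall
      have := Fintype.ofFinite (GaloisField 2 2)
      have hsub : (Finset.univ : Finset (GaloisField 2 2)) ⊆ {0, 1} := fun α _ => by
        by_cases h0 : α = 0
        · simp [h0]
        · simp [hall α h0]
      have := (Finset.card_le_card hsub).trans Finset.card_le_two
      rw [Finset.card_univ, ← Nat.card_eq_fintype_card] at this
      omega
    obtain ⟨i, hi, hi0⟩ := hmin Nat.prime_two (by rw [hp3]; rfl) hα0 hα1
    have hi2 : (P i).natDegree = 2 := by
      rw [hi, natDegree_minpoly_galoisField Nat.prime_two hα0 hα1]
    refine prod_sum_pow_ne_of_unique_min_degree Finset.univ P (Finset.mem_univ i) hi2 two_pos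
      (fun k _ hk => ?_) (e := fun i => 2 * h i) (by simpa using hi0) hperf
    have h2 := (hP k).two_le_natDegree
    by_contra hlt
    exact hk (hinj ((hP k).eq_of_natDegree_eq_two (hP i) (by omega) hi2))
  rcases hp with ⟨⟨-, n, hpn⟩, hp7⟩ | ⟨⟨-, n, hpn⟩, hp5⟩
  · have hn : n.Prime := Nat.Prime.of_mersenne (hpn ▸ hprime)
    have hn2 : n ≠ 2 := by rintro rfl; exact hp3 hpn
    have hn3 : n ≠ 3 := by rintro rfl; exact hp7 hpn
    have hn4 : n ≠ 4 := by rintro rfl; exact absurd hn (by norm_num)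
    obtain ⟨α, h0, h1, hα⟩ := exists_not_isMersennePrime_minpoly hn (by have := hn.two_le; omega)
    obtain ⟨i, hi, -⟩ := hmin hn hpn h0 h1
    exact hα (hi ▸ hP i)
  · have hn2 : 2 ≤ n := by
      rcases n with _ | _ | n
      · exact absurd hpn hp3
      · exact absurd hpn hp5
      · omega
    obtain ⟨Q, hQ, hQd⟩ := WfDvdMonoid.exists_irreducible_factor
      (not_isUnit_geom_sum (by have := (hP j).two_le_natDegree; omega) hprime.two_le)
      (ne_zero_of_dvd_ne_zero (Finset.prod_ne_zero_iff.2 fun i _ =>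
        pow_ne_zero _ (hP i).1.ne_zero) hgeom)
    obtain ⟨i, hi, -⟩ := hfactor hQ hQd
    have h8 : 8 ∣ Q.natDegree := by
      refine eight_dvd_of_fermatNumber_dvd (hpn ▸ hprime) hn2 (hpn ▸ ?_)
      refine dvd_two_pow_sub_one_of_dvd_geom_sum hprime ?_ hQ hQd
      rw [hpn]
      exact (Nat.two_lt_fermatNumber n).ne'
    obtain ⟨hirr, c, d, hc, hd, hcd⟩ := hP i
    rw [← hi, hcd, (monic_one_add_X_pow_mul (by omega)).2] at h8
    exact not_eight_dvd_of_irreducible hc hd (hcd ▸ hirr) h8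

end F2Poly

theorem theorem1p2 :
    (¬ ∃ S : (ZMod 2)[X], F2Poly.IsSpecial S ∧ F2Poly.IsPerfect S ∧
      ∀ P : (ZMod 2)[X], Irreducible P → P ∣ S → F2Poly.IsMersennePrime P) ∧
    (∀ (m : ℕ) (P : Fin m → (ZMod 2)[X]) (h : Fin m → ℕ),
      Function.Injective P →
      (∀ j, F2Poly.IsMersennePrime (P j)) →
      (∃ (j : Fin m) (p : ℕ), p ∣ 2 * h j + 1 ∧
        ((F2Poly.IsMersennePrimeNumber p ∧ p ≠ 7) ∨ (F2Poly.IsFermatPrimeNumber p ∧ p ≠ 5))) →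
      ¬ F2Poly.IsPerfect (∏ j, P j ^ (2 * h j))) := by
  refine ⟨?_, fun m P h hinj hP ⟨j, p, hdvd, hp⟩ => F2Poly.not_isPerfect_prod P h hinj hP hdvd hp⟩
  rintro ⟨S, ⟨m, P, hm, hinj, hirr, rfl⟩, hperf, hmer⟩
  have hP (j : Fin m) : F2Poly.IsMersennePrime (P j) :=
    hmer _ (hirr j).1 ((dvd_pow_self _ two_ne_zero).trans
      (Finset.dvd_prod_of_mem _ (Finset.mem_univ j)))
  exact F2Poly.not_isPerfect_prod P (fun _ => 1) hinj hP (j := ⟨0, hm⟩) (p := 3) (by norm_num)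
    (Or.inl ⟨⟨Nat.prime_three, 2, rfl⟩, by norm_num⟩) hperf
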